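/- Let $\mathrm{Sym}\subseteq\mathbb R[[x_1,x_2,\dots]]$ be the real algebra of symmetric functions, i.e. the linear span of the power sum symmetric functions $p_\alpha=\prod_{i=1}^{\ell(\alpha)}p_{\alpha_i}$, where $p_i=\sum_{j\ge1}x_j^i$ and $\alpha=(\alpha_1\ge\dots\ge\alpha_{\ell(\alpha)}\ge 1)$ ranges over all integer partitions (including the empty one, with $p_\emptyset=1$). Then there is exactly one homomorphism of $\mathbb R$-algebras $\varphi:\mathrm{Sym}\to\mathbb R[t]$ with $$\varphi(p_\alpha)=\Big(\prod_{i=1}^{\ell(\alpha)}\alpha_i\Big)t^{\ell(\alpha)}\qquad\text{for every partition }\alpha,$$ and the following holds for it. Let $F$ be a finite forest with vertex set $V$ and let $\upsilon:V\to\mathbb Z_{>0}$ be a vertex weighting. Let $$X_{(F,\upsilon)}=\sum_{\kappa}\prod_{v\in V}x_{\kappa(v)}^{\upsilon(v)}$$ be its chromatic symmetric function, where the sum is over all proper colourings $\kappa:V\to\{1,2,\dots\}$ of $F$, and let $$P_{(F,\upsilon)}(t)=\det(tW_\upsilon-L_F),$$ where $W_\upsilon$ is the diagonal matrix of the vertex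 weights and $L_F=D_F-A_F$ is the combinatorial Laplacian (degree matrix minus adjacency matrix) of $F$. Then $X_{(F,\upsilon)}\in\mathrm{Sym}$ and $$P_{(F,\upsilon)}(t)=\varphi(X_{(F,\upsilon)}).$$ -/

import Mathlib

open Polynomial

noncomputable section

namespace CSF

/-- The formal sum of a family of power series in the variables `x_1, x_2, …`, taken coefficient by
coefficient. It is meaningful when each monomial occurs in only finitely many members of the
family, which is proved below for the two families it is used with. -/
def formalSum {ι : Type*} (f : ι → MvPowerSeries ℕ+ ℝ) : MvPowerSeries ℕ+ ℝ :=
  fun d => ∑ᶠ k, MvPowerSeries.coeff d (f k)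

/-- The power sum `p_i = ∑_j x_j ^ i` (for `i ≥ 1`). -/
def powerSum (i : ℕ) : MvPowerSeries ℕ+ ℝ :=
  formalSum fun j : ℕ+ => (MvPowerSeries.X j : MvPowerSeries ℕ+ ℝ) ^ i

/-- The power sum symmetric function `p_α = ∏_i p_{α_i}` of an integer partition `α`. -/
def powerSumPart {n : ℕ} (α : n.Partition) : MvPowerSeries ℕ+ ℝ :=
  (α.parts.map powerSum).prod

/-- `Sym`, the algebra of symmetric functions: the subalgebra of `ℝ⟦x_1, x_2, …⟧` generated by the
`p_α`. It is also their linear span, see `toSubmodule_symAlg`. -/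
def SymAlg : Subalgebra ℝ (MvPowerSeries ℕ+ ℝ) :=
  Algebra.adjoin ℝ {f | ∃ (n : ℕ) (α : n.Partition), f = powerSumPart α}

lemma powerSumPart_mem {n : ℕ} (α : n.Partition) : powerSumPart α ∈ SymAlg :=
  Algebra.subset_adjoin ⟨n, α, rfl⟩

/-- The monomial `∏_v x_{κ(v)} ^ υ(v)` of a colouring `κ`. -/
def colourMonomial {V : Type*} [Fintype V] (υ : V → ℕ+) (κ : V → ℕ+) : MvPowerSeries ℕ+ ℝ :=
  ∏ v, (MvPowerSeries.X (κ v) : MvPowerSeries ℕ+ ℝ) ^ (υ v : ℕ)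

/-- The chromatic symmetric function of a graph with positive integer vertex weights:
the sum over all proper colourings `κ : V → {1, 2, …}` of `∏_v x_{κ(v)} ^ υ(v)`. -/
def chromSymm {V : Type*} [Fintype V] (G : SimpleGraph V) (υ : V → ℕ+) :
    MvPowerSeries ℕ+ ℝ :=
  formalSum fun κ : G.Coloring ℕ+ => colourMonomial υ κ

/-- The weighted Laplacian characteristic polynomial `P_{(G,υ)}(t) = det (t W_υ - L_G)`, where `W_υ`
is the diagonal matrix of vertex weights and `L_G = D_G - A_G` is the combinatorial Laplacian. -/
def lapPoly {V : Type*} [Fintype V] [DecidableEq V] (G : SimpleGraph V) [DecidableRel G.Adj]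
    (υ : V → ℕ+) : ℝ[X] :=
  Matrix.det ((X : ℝ[X]) • Matrix.diagonal (fun v => C ((υ v : ℕ) : ℝ)) - (G.lapMatrix ℝ).map C)

/-- The algebra homomorphism `φ` sends `p_α` to `(∏_i α_i) t ^ ℓ(α)` for every partition `α`. -/
def IsPhi (φ : SymAlg →ₐ[ℝ] ℝ[X]) : Prop :=
  ∀ (n : ℕ) (α : n.Partition), φ ⟨powerSumPart α, powerSumPart_mem α⟩ =
    C ((α.parts.prod : ℕ) : ℝ) * X ^ α.parts.card

/- Sanity facts: the formal sums above are locally finite, and `Sym` is spanned by the `p_α`. -/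

lemma powerSum_finite {i : ℕ} (hi : i ≠ 0) (d : ℕ+ →₀ ℕ) :
    (Function.support fun j : ℕ+ =>
      MvPowerSeries.coeff d ((MvPowerSeries.X j : MvPowerSeries ℕ+ ℝ) ^ i)).Finite := by
  classical
  refine d.support.finite_toSet.subset fun j hj => ?_
  simp only [Function.mem_support, MvPowerSeries.coeff_X_pow, ne_eq, ite_eq_right_iff,
    Classical.not_imp] at hj
  simp [hj.1, hi]

lemma colourMonomial_eq {V : Type*} [Fintype V] (υ : V → ℕ+) (κ : V → ℕ+) :
    colourMonomial υ κ =
      MvPowerSeries.monomial (∑ v, Finsupp.single (κ v) (υ v : ℕ)) (1 : ℝ) := by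
  classical
  unfold colourMonomial
  simp only [MvPowerSeries.X_pow_eq]
  induction (Finset.univ : Finset V) using Finset.induction_on with
  | empty => simp
  | insert a s ha ih =>
    rw [Finset.prod_insert ha, Finset.sum_insert ha, ih, MvPowerSeries.monomial_mul_monomial,
      one_mul]

lemma chromSymm_finite {V : Type*} [Fintype V] (G : SimpleGraph V) (υ : V → ℕ+) (d : ℕ+ →₀ ℕ) :
    (Function.support fun κ : G.Coloring ℕ+ =>
      MvPowerSeries.coeff d (colourMonomial υ κ)).Finite := by
  classical
  have hfin : (Set.univ.pi fun _ : V => (d.support : Set ℕ+)).Finite :=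
    Set.Finite.pi fun _ => d.support.finite_toSet
  refine (hfin.preimage (f := fun κ : G.Coloring ℕ+ => (κ : V → ℕ+))
    DFunLike.coe_injective.injOn).subset fun κ hκ => ?_
  simp only [Function.mem_support, colourMonomial_eq, MvPowerSeries.coeff_monomial, ne_eq,
    ite_eq_right_iff, Classical.not_imp] at hκ
  intro v _
  have h := hκ.1
  simp only [Finset.mem_coe, Finsupp.mem_support_iff, h, Finsupp.finsetSum_apply]
  intro h0
  have := (Finset.sum_eq_zero_iff.mp h0) v (Finset.mem_univ v)
  simp at this

lemma toSubmodule_symAlg :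
    Subalgebra.toSubmodule SymAlg =
      Submodule.span ℝ {f | ∃ (n : ℕ) (α : n.Partition), f = powerSumPart α} := by
  have key : (Submonoid.closure {f | ∃ (n : ℕ) (α : n.Partition), f = powerSumPart α} :
      Set (MvPowerSeries ℕ+ ℝ)) = {f | ∃ (n : ℕ) (α : n.Partition), f = powerSumPart α} := by
    refine Set.Subset.antisymm (fun f hf => ?_) Submonoid.subset_closure
    induction hf using Submonoid.closure_induction with
    | mem f hf => exact hf
    | one => exact ⟨0, ⟨0, by simp, by simp⟩, by simp [powerSumPart]⟩
    | mul f g _ _ hf hg =>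
      obtain ⟨n, α, rfl⟩ := hf
      obtain ⟨m, β, rfl⟩ := hg
      refine ⟨n + m, ⟨α.parts + β.parts, ?_, ?_⟩, by simp [powerSumPart]⟩
      · intro i hi
        rcases Multiset.mem_add.mp hi with h | h
        · exact α.parts_pos h
        · exact β.parts_pos h
      · simp [α.parts_sum, β.parts_sum]
  rw [SymAlg, Algebra.adjoin_eq_span, key]

end CSF

end

/-! ### Algebraic independence of the power sums. -/

noncomputable section

namespace CSF

/-! The `p_i` with `i ≥ 1` generate `SymAlg` and are algebraically independent, so `φ` exists, is
unique, and is determined by `p_i ↦ i t`. For independence, every monomial of a product of `k` power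
sums has at most `k` variables, and one with exactly `k` variables reveals the factors as its
exponents; a term with the most factors therefore cannot cancel
(`card_exponents_le_of_coeff_ne_zero`).

The identity holds because both sides obey one recurrence. A nonempty forest has a vertex `v`, of
weight `w` say, with at most one neighbour. If `v` is isolated, removing it costs a factor `p_w` in
`X` and `w t` in `P`. If `v` is a leaf at `u`, then `X_F = p_w X_{F-v} - X_{F/uv}` and `P_F = w t
P_{F-v} - P_{F/uv}` (`chromSymm_add_of_leaf`, `lapPoly_of_leaf`), where `F/uv` is `F-v` with `w`
added to the weight of `u`. As `φ(p_w) = w t`, induction on the number of vertices concludes. -/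

lemma coeff_powerSum (i : ℕ) (d : ℕ+ →₀ ℕ) :
    MvPowerSeries.coeff d (powerSum i) =
      ∑ᶠ j : ℕ+, MvPowerSeries.coeff d ((MvPowerSeries.X j : MvPowerSeries ℕ+ ℝ) ^ i) := rfl

lemma coeff_powerSum_nonneg (i : ℕ) (d : ℕ+ →₀ ℕ) : 0 ≤ MvPowerSeries.coeff d (powerSum i) := by
  classical
  rw [coeff_powerSum]
  refine finsum_nonneg fun j => ?_
  rw [MvPowerSeries.coeff_X_pow]
  split_ifs <;> simp

lemma exists_eq_single_of_coeff_powerSum_ne_zero {i : ℕ} {d : ℕ+ →₀ ℕ}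
    (h : MvPowerSeries.coeff d (powerSum i) ≠ 0) : ∃ j, d = Finsupp.single j i := by
  classical
  by_contra! hd
  refine h ?_
  rw [coeff_powerSum]
  exact finsum_eq_zero_of_forall_eq_zero fun j => by simp [MvPowerSeries.coeff_X_pow, hd j]

lemma coeff_single_powerSum {i : ℕ} (hi : i ≠ 0) (j : ℕ+) :
    MvPowerSeries.coeff (Finsupp.single j i) (powerSum i) = 1 := by
  classical
  rw [coeff_powerSum, finsum_eq_single _ j]
  · simp [MvPowerSeries.coeff_X_pow]
  · intro k hk
    simp [MvPowerSeries.coeff_X_pow, Finsupp.single_left_inj hi, hk.symm]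

/-- The product of the power sums indexed by a multiset of positive integers. -/
def powerSumProd (s : Multiset ℕ+) : MvPowerSeries ℕ+ ℝ :=
  (s.map fun i : ℕ+ => powerSum i).prod

lemma powerSumProd_cons (i : ℕ+) (s : Multiset ℕ+) :
    powerSumProd (i ::ₘ s) = powerSum i * powerSumProd s := by
  simp [powerSumProd]

/-- Nonnegativity excludes cancellation, so one positive contribution suffices in
`exists_exponents_eq_coeff_pos`. -/
lemma coeff_powerSumProd_nonneg (s : Multiset ℕ+) (d : ℕ+ →₀ ℕ) :
    0 ≤ MvPowerSeries.coeff d (powerSumProd s) := by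
  classical
  induction s using Multiset.induction_on generalizing d with
  | empty =>
    simp only [powerSumProd, Multiset.map_zero, Multiset.prod_zero, MvPowerSeries.coeff_one]
    split_ifs <;> simp
  | cons i s ih =>
    rw [powerSumProd_cons, MvPowerSeries.coeff_mul]
    exact Finset.sum_nonneg fun p _ => mul_nonneg (coeff_powerSum_nonneg _ _) (ih _)

/-- The multiset of the nonzero exponents of a monomial. -/
def exponents (d : ℕ+ →₀ ℕ) : Multiset ℕ := d.support.val.map d

lemma exponents_single_add {i : ℕ} (hi : i ≠ 0) {j : ℕ+} {d : ℕ+ →₀ ℕ} (hj : d j = 0) :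
    exponents (Finsupp.single j i + d) = i ::ₘ exponents d := by
  classical
  have hj' : j ∉ d.support := by simpa using hj
  have hs : (Finsupp.single j i + d).support = insert j d.support := by
    rw [Finsupp.support_add_eq, Finsupp.support_single _ hi, Finset.insert_eq]
    rw [Finsupp.support_single _ hi]
    simpa using hj
  rw [exponents, hs, Finset.insert_val_of_notMem hj', Multiset.map_cons]
  congr 1
  · simp [hj]
  · refine Multiset.map_congr rfl fun k hk => ?_
    have : j ≠ k := fun h => hj' (h ▸ hk)
    simp [this]

lemma card_exponents_single_add_le (i : ℕ) (j : ℕ+) (d : ℕ+ →₀ ℕ) :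
    (exponents (Finsupp.single j i + d)).card ≤ (exponents d).card + 1 := by
  classical
  simp only [exponents, Multiset.card_map, Finset.card_val]
  refine (Finset.card_le_card Finsupp.support_add).trans ((Finset.card_union_le _ _).trans ?_)
  have := Finset.card_le_card (Finsupp.support_single_subset (a := j) (b := i))
  simp only [Finset.card_singleton] at this
  lia

lemma card_exponents_single_add_of_ne {i : ℕ} {j : ℕ+} {d : ℕ+ →₀ ℕ} (hj : d j ≠ 0) :
    (exponents (Finsupp.single j i + d)).card ≤ (exponents d).card := by
  classical
  simp only [exponents, Multiset.card_map, Finset.card_val]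
  refine Finset.card_le_card (Finsupp.support_add.trans (Finset.union_subset ?_ subset_rfl))
  exact Finsupp.support_single_subset.trans (by simpa using hj)

/-- A monomial of `p_s` has at most as many variables as `s` has parts, and if it has as many then
its exponents are the parts of `s`. -/
lemma card_exponents_le_of_coeff_ne_zero {s : Multiset ℕ+} {d : ℕ+ →₀ ℕ}
    (h : MvPowerSeries.coeff d (powerSumProd s) ≠ 0) :
    (exponents d).card ≤ s.card ∧
      (s.card ≤ (exponents d).card → exponents d = s.map (fun i : ℕ+ => (i : ℕ))) := by
  classical
  induction s using Multiset.induction_on generalizing d with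
  | empty =>
    have hd : d = 0 := by
      by_contra hd
      simp [powerSumProd, MvPowerSeries.coeff_one, hd] at h
    simp [hd, exponents]
  | cons i s ih =>
    rw [powerSumProd_cons, MvPowerSeries.coeff_mul] at h
    obtain ⟨⟨a, b⟩, hab, hne⟩ := Finset.exists_ne_zero_of_sum_ne_zero h
    obtain ⟨j, rfl⟩ := exists_eq_single_of_coeff_powerSum_ne_zero (left_ne_zero_of_mul hne)
    obtain ⟨hle, heq⟩ := ih (right_ne_zero_of_mul hne)
    obtain rfl : Finsupp.single j (i : ℕ) + b = d := Finset.HasAntidiagonal.mem_antidiagonal.mp hab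
    have h1 := card_exponents_single_add_le i j b
    rw [Multiset.card_cons]
    refine ⟨by lia, fun hge => ?_⟩
    by_cases hj : b j = 0
    · rw [exponents_single_add i.ne_zero hj, heq (by lia), Multiset.map_cons]
    · have := card_exponents_single_add_of_ne (i := i) hj
      lia

/-- Each part is given a fresh variable. -/
lemma exists_exponents_eq_coeff_pos (s : Multiset ℕ+) :
    ∃ d : ℕ+ →₀ ℕ, exponents d = s.map (fun i : ℕ+ => (i : ℕ)) ∧
      0 < MvPowerSeries.coeff d (powerSumProd s) := by
  classical
  induction s using Multiset.induction_on with
  | empty => exact ⟨0, by simp [exponents], by simp [powerSumProd]⟩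
  | cons i s ih =>
    obtain ⟨d, hd, hpos⟩ := ih
    obtain ⟨j, hj⟩ := Infinite.exists_notMem_finset d.support
    refine ⟨Finsupp.single j (i : ℕ) + d, ?_, ?_⟩
    · rw [exponents_single_add i.ne_zero (by simpa using hj), hd, Multiset.map_cons]
    · rw [powerSumProd_cons, MvPowerSeries.coeff_mul]
      refine Finset.sum_pos' (fun p _ => mul_nonneg (coeff_powerSum_nonneg _ _)
        (coeff_powerSumProd_nonneg _ _)) ⟨(Finsupp.single j (i : ℕ), d), by simp, ?_⟩
      rw [coeff_single_powerSum i.ne_zero, one_mul]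
      exact hpos

lemma aeval_powerSum (p : MvPolynomial ℕ+ ℝ) :
    MvPolynomial.aeval (fun i : ℕ+ => powerSum i) p =
      ∑ m ∈ p.support, p.coeff m • powerSumProd m.toMultiset := by
  conv_lhs => rw [p.as_sum, map_sum]
  refine Finset.sum_congr rfl fun m _ => ?_
  rw [MvPolynomial.aeval_monomial, Algebra.smul_def, powerSumProd, Finsupp.toMultiset_map,
    Finsupp.prod_toMultiset, Finsupp.prod_mapDomain_index (by simp) (by simp [pow_add])]

/-- The power sums `p_1, p_2, …` in infinitely many variables are algebraically independent. -/
theorem algebraicIndependent_powerSum :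
    AlgebraicIndependent ℝ (fun i : ℕ+ => powerSum i) := by
  rw [algebraicIndependent_iff]
  intro p hp
  by_contra hne
  -- `m` is a term with the most power sum factors, counted with multiplicity; `d` is a monomial of
  -- it with all variables distinct. By maximality no other term contains `d`.
  obtain ⟨m, hm, hmax⟩ := p.support.exists_max_image (fun m => m.toMultiset.card)
    (Finset.nonempty_iff_ne_empty.mpr fun h => hne (MvPolynomial.support_eq_empty.mp h))
  obtain ⟨d, hd, hpos⟩ := exists_exponents_eq_coeff_pos m.toMultiset
  have h0 := congrArg (MvPowerSeries.coeff d) hp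
  rw [aeval_powerSum, map_sum, map_zero, Finset.sum_eq_single m] at h0
  · rw [map_smul, smul_eq_mul] at h0
    exact (mul_ne_zero (MvPolynomial.mem_support_iff.mp hm) hpos.ne') h0
  · intro m' hm' hmm
    by_contra hc
    rw [map_smul, smul_eq_mul] at hc
    obtain ⟨-, heq⟩ := card_exponents_le_of_coeff_ne_zero (right_ne_zero_of_mul hc)
    have := heq (by rw [hd, Multiset.card_map]; exact hmax m' hm')
    rw [hd] at this
    exact hmm (Multiset.toFinsupp.symm.injective
      (Multiset.map_injective PNat.coe_injective this)).symm
  · exact fun h => absurd hm h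

/-! ### Existence and uniqueness of `φ`. -/

lemma exists_powerSumPart_eq (i : ℕ+) :
    ∃ α : (i : ℕ).Partition, α.parts = {(i : ℕ)} ∧ powerSumPart α = powerSum i :=
  ⟨⟨{(i : ℕ)}, by simp [i.pos], by simp⟩, rfl, by simp [powerSumPart]⟩

lemma powerSum_mem (i : ℕ+) : powerSum i ∈ SymAlg := by
  obtain ⟨α, -, h⟩ := exists_powerSumPart_eq i
  exact h ▸ powerSumPart_mem α

lemma IsPhi.map_powerSum {φ : SymAlg →ₐ[ℝ] ℝ[X]} (h : IsPhi φ) (i : ℕ+) :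
    φ ⟨powerSum i, powerSum_mem i⟩ = C ((i : ℕ) : ℝ) * X := by
  obtain ⟨α, hα, h'⟩ := exists_powerSumPart_eq i
  simpa [h', hα] using h _ α

lemma exists_multiset_powerSumPart_eq {n : ℕ} (α : n.Partition) :
    ∃ s : Multiset ℕ+, α.parts = s.map (fun i : ℕ+ => (i : ℕ)) ∧
      powerSumPart α = powerSumProd s := by
  let f (i : {i // i ∈ α.parts}) : ℕ+ := Nat.toPNat i.1 (α.parts_pos i.2)
  have hf : α.parts = (α.parts.attach.map f).map (fun i : ℕ+ => (i : ℕ)) := by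
    rw [Multiset.map_map]
    exact (Multiset.attach_map_val α.parts).symm
  refine ⟨α.parts.attach.map f, hf, ?_⟩
  rw [powerSumPart, powerSumProd]
  conv_lhs => rw [hf, Multiset.map_map]
  rfl

lemma powerSumProd_mem (s : Multiset ℕ+) : powerSumProd s ∈ SymAlg :=
  SymAlg.multiset_prod_mem fun f hf => by
    obtain ⟨i, -, rfl⟩ := Multiset.mem_map.mp hf
    exact powerSum_mem i

lemma map_powerSumProd {φ : SymAlg →ₐ[ℝ] ℝ[X]}
    (h : ∀ i : ℕ+, φ ⟨powerSum i, powerSum_mem i⟩ = C ((i : ℕ) : ℝ) * X) (s : Multiset ℕ+) :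
    φ ⟨powerSumProd s, powerSumProd_mem s⟩ =
      C (((s.map fun i : ℕ+ => (i : ℕ)).prod : ℕ) : ℝ) * X ^ s.card := by
  induction s using Multiset.induction_on with
  | empty =>
    have : (⟨powerSumProd 0, powerSumProd_mem 0⟩ : SymAlg) = 1 :=
      Subtype.ext (by simp [powerSumProd])
    simp [this]
  | cons i s ih =>
    have : (⟨powerSumProd (i ::ₘ s), powerSumProd_mem _⟩ : SymAlg) =
        ⟨powerSum i, powerSum_mem i⟩ * ⟨powerSumProd s, powerSumProd_mem s⟩ :=
      Subtype.ext (powerSumProd_cons i s)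
    rw [this, map_mul, h, ih, Multiset.map_cons, Multiset.prod_cons, Multiset.card_cons,
      Nat.cast_mul, C_mul, pow_succ]
    ring

lemma isPhi_of_map_powerSum {φ : SymAlg →ₐ[ℝ] ℝ[X]}
    (h : ∀ i : ℕ+, φ ⟨powerSum i, powerSum_mem i⟩ = C ((i : ℕ) : ℝ) * X) : IsPhi φ := by
  intro n α
  obtain ⟨s, hs, hα⟩ := exists_multiset_powerSumPart_eq α
  have : (⟨powerSumPart α, powerSumPart_mem α⟩ : SymAlg) = ⟨powerSumProd s, powerSumProd_mem s⟩ :=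
    Subtype.ext hα
  rw [this, map_powerSumProd h, hs, Multiset.card_map]

/-- Identifies `SymAlg` with the algebra that `aevalEquiv` presents as a polynomial ring. -/
lemma symAlg_eq_adjoin_powerSum :
    SymAlg = Algebra.adjoin ℝ (Set.range fun i : ℕ+ => powerSum i) := by
  refine le_antisymm (Algebra.adjoin_le ?_) (Algebra.adjoin_le ?_)
  · rintro _ ⟨n, α, rfl⟩
    obtain ⟨s, -, h⟩ := exists_multiset_powerSumPart_eq α
    rw [SetLike.mem_coe, h]
    refine Subalgebra.multiset_prod_mem _ fun f hf => ?_
    obtain ⟨i, -, rfl⟩ := Multiset.mem_map.mp hf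
    exact Algebra.subset_adjoin ⟨i, rfl⟩
  · rintro _ ⟨i, rfl⟩
    exact powerSum_mem i

theorem existsUnique_isPhi : ∃! φ : SymAlg →ₐ[ℝ] ℝ[X], IsPhi φ := by
  refine existsUnique_of_exists_of_unique ?_ fun φ ψ hφ hψ => ?_
  · refine ⟨(MvPolynomial.aeval fun i : ℕ+ => C ((i : ℕ) : ℝ) * X).comp
      (algebraicIndependent_powerSum.aevalEquiv.symm.toAlgHom.comp
        (Subalgebra.equivOfEq _ _ symAlg_eq_adjoin_powerSum).toAlgHom),
      isPhi_of_map_powerSum fun i => ?_⟩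
    have : algebraicIndependent_powerSum.aevalEquiv.symm
        (Subalgebra.equivOfEq _ _ symAlg_eq_adjoin_powerSum ⟨powerSum i, powerSum_mem i⟩) =
        MvPolynomial.X i := by
      rw [AlgEquiv.symm_apply_eq]
      refine Subtype.ext ?_
      simp
    change MvPolynomial.aeval _ (algebraicIndependent_powerSum.aevalEquiv.symm
        (Subalgebra.equivOfEq _ _ symAlg_eq_adjoin_powerSum ⟨powerSum i, powerSum_mem i⟩)) = _
    rw [this, MvPolynomial.aeval_X]
  · refine AlgHom.adjoin_ext ?_
    rintro _ ⟨n, α, rfl⟩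
    exact (hφ n α).trans (hψ n α).symm

end CSF

/-! ### The leaf recurrence for the chromatic symmetric function. -/

namespace CSF

lemma formalSum_comp_of_bijective {ι κ : Type*} {e : κ → ι} (he : Function.Bijective e)
    (f : ι → MvPowerSeries ℕ+ ℝ) : formalSum (fun k => f (e k)) = formalSum f := by
  funext d
  exact finsum_comp (g := fun i => MvPowerSeries.coeff d (f i)) e he

/-- Local finiteness matters: `finsum` is `0` on infinite support, so additivity can fail without
it. -/
lemma formalSum_eq_add {ι α β : Type*} {f : ι → MvPowerSeries ℕ+ ℝ}
    (hf : ∀ d, (Function.support fun i => MvPowerSeries.coeff d (f i)).Finite)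
    {a : α → ι} {b : β → ι} (ha : Function.Injective a) (hb : Function.Injective b)
    (hab : IsCompl (Set.range a) (Set.range b)) :
    formalSum f = formalSum (fun i => f (a i)) + formalSum (fun i => f (b i)) := by
  funext d
  change ∑ᶠ i, MvPowerSeries.coeff d (f i) =
    (∑ᶠ i, MvPowerSeries.coeff d (f (a i))) + ∑ᶠ i, MvPowerSeries.coeff d (f (b i))
  rw [← finsum_mem_range (f := fun i => MvPowerSeries.coeff d (f i)) ha,
    ← finsum_mem_range (f := fun i => MvPowerSeries.coeff d (f i)) hb,
    ← finsum_mem_union' hab.disjoint ((hf d).subset Set.inter_subset_right)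
      ((hf d).subset Set.inter_subset_right), show Set.range a ∪ Set.range b = Set.univ from hab.sup_eq_top,
    finsum_mem_univ]

lemma finite_support_coeff_mul {ι κ : Type*} {f : ι → MvPowerSeries ℕ+ ℝ}
    {g : κ → MvPowerSeries ℕ+ ℝ}
    (hf : ∀ d, (Function.support fun i => MvPowerSeries.coeff d (f i)).Finite)
    (hg : ∀ d, (Function.support fun i => MvPowerSeries.coeff d (g i)).Finite) (d : ℕ+ →₀ ℕ) :
    (Function.support fun p : ι × κ => MvPowerSeries.coeff d (f p.1 * g p.2)).Finite := by
  classical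
  refine ((Finset.HasAntidiagonal.antidiagonal d).finite_toSet.biUnion fun c _ => (hf c.1).prod (hg c.2)).subset
    fun p hp => ?_
  rw [Function.mem_support, MvPowerSeries.coeff_mul] at hp
  obtain ⟨c, hc, hne⟩ := Finset.exists_ne_zero_of_sum_ne_zero hp
  exact Set.mem_biUnion hc ⟨left_ne_zero_of_mul hne, right_ne_zero_of_mul hne⟩

lemma formalSum_mul_formalSum {ι κ : Type*} {f : ι → MvPowerSeries ℕ+ ℝ}
    {g : κ → MvPowerSeries ℕ+ ℝ}
    (hf : ∀ d, (Function.support fun i => MvPowerSeries.coeff d (f i)).Finite)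
    (hg : ∀ d, (Function.support fun i => MvPowerSeries.coeff d (g i)).Finite) :
    formalSum f * formalSum g = formalSum fun p : ι × κ => f p.1 * g p.2 := by
  classical
  ext d
  have hprod (c : (ℕ+ →₀ ℕ) × (ℕ+ →₀ ℕ)) : (Function.support fun p : ι × κ =>
      MvPowerSeries.coeff c.1 (f p.1) * MvPowerSeries.coeff c.2 (g p.2)).Finite :=
    ((hf c.1).prod (hg c.2)).subset fun p hp =>
      ⟨left_ne_zero_of_mul hp, right_ne_zero_of_mul hp⟩
  rw [MvPowerSeries.coeff_mul]
  change _ = ∑ᶠ p : ι × κ, MvPowerSeries.coeff d (f p.1 * g p.2)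
  simp only [MvPowerSeries.coeff_mul]
  rw [finsum_sum_comm _ _ fun c _ => hprod c]
  refine Finset.sum_congr rfl fun c _ => ?_
  rw [finsum_curry _ (hprod c)]
  change (∑ᶠ i, MvPowerSeries.coeff c.1 (f i)) * (∑ᶠ i, MvPowerSeries.coeff c.2 (g i)) = _
  rw [finsum_mul]
  exact finsum_congr fun i => mul_finsum _ _

section Graph

variable {V W : Type*}

/-- Relabelling lets the vertex to be removed be the `Unit` summand of `W ⊕ Unit`. -/
lemma chromSymm_comap_equiv [Fintype V] [Fintype W] (e : W ≃ V) (G : SimpleGraph V) (υ : V → ℕ+) :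
    chromSymm (G.comap e) (υ ∘ e) = chromSymm G υ := by
  refine Eq.trans ?_ (formalSum_comp_of_bijective
    (e := fun κ : (G.comap e).Coloring ℕ+ =>
      (SimpleGraph.Coloring.mk (fun v => κ (e.symm v)) fun {v w} h =>
        κ.valid (by simpa using h) : G.Coloring ℕ+)) ⟨fun κ κ' h => ?_, fun κ => ?_⟩ _)
  · refine congrArg formalSum (funext fun κ => ?_)
    rw [colourMonomial, colourMonomial, ← e.prod_comp]
    refine Finset.prod_congr rfl fun w _ => ?_
    change _ = MvPowerSeries.X (κ (e.symm (e w))) ^ (υ (e w) : ℕ)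
    rw [e.symm_apply_apply]
    rfl
  · refine DFunLike.ext _ _ fun w => ?_
    have h' : κ (e.symm (e w)) = κ' (e.symm (e w)) := DFunLike.congr_fun h (e w)
    rwa [e.symm_apply_apply] at h'
  · refine ⟨SimpleGraph.Coloring.mk (fun w => κ (e w)) fun {v w} h => κ.valid h,
      DFunLike.ext _ _ fun v => ?_⟩
    exact congrArg κ (e.apply_symm_apply v)

lemma chromSymm_of_isEmpty [Fintype V] [IsEmpty V] (G : SimpleGraph V) (υ : V → ℕ+) : chromSymm G υ = 1 := by
  have : Unique (G.Coloring ℕ+) :=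
    { default := SimpleGraph.Coloring.mk isEmptyElim fun {v} => isEmptyElim v
      uniq := fun κ => by ext v; exact isEmptyElim v }
  ext d
  change ∑ᶠ κ : G.Coloring ℕ+, _ = _
  rw [finsum_unique]
  simp [colourMonomial]

variable (G : SimpleGraph (W ⊕ Unit)) (υ : W ⊕ Unit → ℕ+)

/-- Restrict a colouring of `W ⊕ Unit` to `W`, remembering the colour of the extra vertex. -/
def splitColoring (κ : G.Coloring ℕ+) : ℕ+ × (G.comap Sum.inl).Coloring ℕ+ :=
  (κ (Sum.inr ()), SimpleGraph.Coloring.mk (fun w => κ (Sum.inl w)) fun {_ _} h => κ.valid h)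

lemma splitColoring_injective : Function.Injective (splitColoring G) := by
  intro κ κ' h
  refine DFunLike.ext _ _ fun v => ?_
  obtain w | _ := v
  · exact DFunLike.congr_fun (congrArg Prod.snd h) w
  · exact congrArg Prod.fst h

lemma range_splitColoring :
    Set.range (splitColoring G) =
      {p | ∀ w, G.Adj (Sum.inr ()) (Sum.inl w) → p.1 ≠ p.2 w} := by
  ext p
  constructor
  · rintro ⟨κ, rfl⟩ w hw
    exact κ.valid hw
  · intro hp
    refine ⟨SimpleGraph.Coloring.mk (Sum.elim p.2 fun _ => p.1) ?_, ?_⟩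
    · rintro (v | ⟨⟩) (w | ⟨⟩) h
      · exact p.2.valid h
      · exact (hp v h.symm).symm
      · exact hp w h
      · exact absurd h (G.loopless.irrefl _)
    · exact Prod.ext rfl (by ext w; rfl)

variable [Fintype W]

lemma colourMonomial_splitColoring (κ : G.Coloring ℕ+) :
    colourMonomial υ κ = (MvPowerSeries.X (splitColoring G κ).1) ^ (υ (Sum.inr ()) : ℕ) *
      colourMonomial (υ ∘ Sum.inl) (splitColoring G κ).2 := by
  rw [colourMonomial, Fintype.prod_sum_type, mul_comm]
  rw [Fintype.prod_unique]
  rfl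

/-- The factor `p_i` colours an extra vertex of weight `i` with no constraint. -/
lemma powerSum_mul_chromSymm (i : ℕ+) (H : SimpleGraph W) (ω : W → ℕ+) :
    powerSum i * chromSymm H ω = formalSum fun p : ℕ+ × H.Coloring ℕ+ =>
      (MvPowerSeries.X p.1) ^ (i : ℕ) * colourMonomial ω p.2 :=
  formalSum_mul_formalSum (powerSum_finite i.ne_zero) (chromSymm_finite H ω)

/-- An isolated vertex of weight `w` contributes a factor `p_w`. -/
lemma chromSymm_of_isolated (h : ∀ w, ¬ G.Adj (Sum.inr ()) (Sum.inl w)) :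
    chromSymm G υ =
      powerSum (υ (Sum.inr ())) * chromSymm (G.comap Sum.inl) (υ ∘ Sum.inl) := by
  rw [powerSum_mul_chromSymm, ← formalSum_comp_of_bijective (e := splitColoring G)
    ⟨splitColoring_injective G, Set.range_eq_univ.mp ?_⟩]
  · exact congrArg formalSum (funext fun κ => colourMonomial_splitColoring G υ κ)
  · rw [range_splitColoring]
    simp [h]

/-- Deletion–contraction at a leaf. -/
lemma chromSymm_add_of_leaf [DecidableEq W] {u : W}
    (h : ∀ w, G.Adj (Sum.inr ()) (Sum.inl w) ↔ w = u) :
    powerSum (υ (Sum.inr ())) * chromSymm (G.comap Sum.inl) (υ ∘ Sum.inl) =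
      chromSymm G υ + chromSymm (G.comap Sum.inl)
        (Function.update (υ ∘ Sum.inl) u (υ (Sum.inl u) + υ (Sum.inr ()))) := by
  -- Either the free colour differs from that of `u`, giving a proper colouring of `G`, or it equals
  -- it, and the two weights merge at `u`.
  rw [powerSum_mul_chromSymm, formalSum_eq_add (a := splitColoring G)
    (b := fun κ : (G.comap Sum.inl).Coloring ℕ+ => (κ u, κ))
    (finite_support_coeff_mul (powerSum_finite (υ (Sum.inr ())).ne_zero) (chromSymm_finite _ _))
    (splitColoring_injective G) (fun κ κ' hκ => congrArg Prod.snd hκ)]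
  · congr 1
    · exact congrArg formalSum (funext fun κ => (colourMonomial_splitColoring G υ κ).symm)
    · refine congrArg formalSum (funext fun κ => ?_)
      rw [colourMonomial, colourMonomial, Fintype.prod_eq_mul_prod_compl u,
        Fintype.prod_eq_mul_prod_compl u, ← mul_assoc, ← pow_add]
      congr 1
      · simp [add_comm]
      · refine Finset.prod_congr rfl fun w hw => ?_
        rw [Function.update_of_ne (by simpa using hw)]
  · have : Set.range (fun κ : (G.comap Sum.inl).Coloring ℕ+ => (κ u, κ)) =
        (Set.range (splitColoring G))ᶜ := by
      rw [range_splitColoring]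
      ext p
      simp only [Set.mem_range, Set.mem_compl_iff, Set.mem_ofPred_eq, h, forall_eq, not_not]
      constructor
      · rintro ⟨κ, rfl⟩
        rfl
      · exact fun hp => ⟨p.2, Prod.ext hp.symm rfl⟩
    rw [this]
    exact isCompl_compl

end Graph

end CSF

/-! ### The leaf recurrence for the Laplacian determinant. -/

lemma Matrix.det_add_smul_single {n R : Type*} [Fintype n] [DecidableEq n] [CommRing R]
    (M : Matrix n n R) (u : n) (c : R) :
    (M + c • Matrix.single u u 1).det = M.det + c * (M.updateRow u (Pi.single u 1)).det := by
  have : M + c • Matrix.single u u 1 = M.updateRow u (M u + c • Pi.single u 1) := by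
    ext i j
    by_cases hi : i = u
    · subst hi
      simp [Matrix.single_apply, Pi.single_apply, eq_comm]
    · simp [hi, Ne.symm hi]
  rw [this, Matrix.det_updateRow_add, Matrix.det_updateRow_smul, Matrix.updateRow_eq_self]

/-- Expansion of a determinant bordered by a leaf of weight `c` attached at `u`. -/
lemma Matrix.det_fromBlocks_leaf {n R : Type*} [Fintype n] [DecidableEq n] [CommRing R]
    (M : Matrix n n R) (u : n) (c : R) :
    (Matrix.fromBlocks (M - Matrix.single u u 1) (Matrix.replicateCol Unit (Pi.single u 1))
      (Matrix.replicateRow Unit (Pi.single u 1)) (Matrix.diagonal fun _ => c - 1)).det =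
      c * M.det - (M + c • Matrix.single u u 1).det := by
  have hE : Matrix.single u u (1 : R) = Matrix.replicateCol Unit (Pi.single u (1 : R)) *
      Matrix.replicateRow Unit (Pi.single u (1 : R)) := by
    ext i j
    simp [Matrix.mul_apply, Matrix.single_apply, Pi.single_apply, eq_comm, ite_and]
    split_ifs <;> rfl
  -- The corner entry splits as `c - 1 = 1 + (c - 2)`: by linearity in the last row, one summand has
  -- an identity corner and yields to a Schur complement, the other is block triangular.
  have hrow : Matrix.fromBlocks (M - Matrix.single u u 1) (Matrix.replicateCol Unit (Pi.single u 1))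
      (Matrix.replicateRow Unit (Pi.single u 1)) (Matrix.diagonal fun _ => c - 1) =
      (Matrix.fromBlocks (M - Matrix.single u u 1) (Matrix.replicateCol Unit (Pi.single u 1))
        0 1).updateRow (Sum.inr ())
        (Sum.elim (Pi.single u 1) (fun _ => 1) + Sum.elim (0 : n → R) (fun _ => c - 2)) := by
    ext (i | i) (j | j)
    · simp
    · simp
    · simp
    · simp
      ring
  have hone : (Matrix.fromBlocks (M - Matrix.single u u 1)
      (Matrix.replicateCol Unit (Pi.single u 1)) 0 1).updateRow (Sum.inr ())
        (Sum.elim (Pi.single u 1) (fun _ => 1)) =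
      Matrix.fromBlocks (M - Matrix.single u u 1) (Matrix.replicateCol Unit (Pi.single u 1))
        (Matrix.replicateRow Unit (Pi.single u 1)) 1 := by
    ext (i | i) (j | j) <;> simp
  have hzero : (Matrix.fromBlocks (M - Matrix.single u u 1)
      (Matrix.replicateCol Unit (Pi.single u 1)) 0 1).updateRow (Sum.inr ())
        (Sum.elim (0 : n → R) (fun _ => c - 2)) =
      Matrix.fromBlocks (M - Matrix.single u u 1) (Matrix.replicateCol Unit (Pi.single u 1))
        0 (Matrix.diagonal fun _ => c - 2) := by
    ext (i | i) (j | j) <;> simp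
  have hsub : M - Matrix.single u u 1 = M + (-1 : R) • Matrix.single u u 1 := by
    rw [neg_one_smul, sub_eq_add_neg]
  have hsub₂ : M - Matrix.single u u 1 - Matrix.single u u 1 =
      M + (-2 : R) • Matrix.single u u 1 := by
    rw [neg_smul, two_smul]
    abel
  -- With `D = det M` and `N` the determinant of `M` with row `u` replaced by `Pi.single u 1`, both
  -- sides become `(c - 1) D - c N`.
  rw [hrow, Matrix.det_updateRow_add, hone, hzero, Matrix.det_fromBlocks_one₂₂, ← hE,
    Matrix.det_fromBlocks_zero₂₁, hsub₂, hsub, Matrix.det_add_smul_single,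
    Matrix.det_add_smul_single, Matrix.det_add_smul_single]
  simp only [Matrix.det_diagonal, Finset.univ_unique, Finset.prod_singleton]
  ring

namespace CSF

variable {V W : Type*} [Fintype V] [Fintype W] [DecidableEq V] [DecidableEq W]

/-- The matrix `t W_υ - L_G` whose determinant is `lapPoly G υ`. -/
def lapPencil (G : SimpleGraph V) [DecidableRel G.Adj] (υ : V → ℕ+) : Matrix V V ℝ[X] :=
  (X : ℝ[X]) • Matrix.diagonal (fun v => C ((υ v : ℕ) : ℝ)) - (G.lapMatrix ℝ).map C

/-- The degree is kept as a sum of adjacency indicators, which splits over `W ⊕ Unit`;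
`Finset.sum_boole` is later disabled to preserve this form. -/
lemma lapPencil_apply (G : SimpleGraph V) [DecidableRel G.Adj] (υ : V → ℕ+) (v w : V) :
    lapPencil G υ v w =
      (if v = w then X * C ((υ v : ℕ) : ℝ) - ∑ x, if G.Adj v x then 1 else 0 else 0) +
        if G.Adj v w then 1 else 0 := by
  have : ((∑ x, if G.Adj v x then 1 else 0 : ℝ[X])) = C ((G.degree v : ℝ)) := by
    rw [SimpleGraph.degree_eq_sum_if_adj, map_sum]
    exact Finset.sum_congr rfl fun x _ => by split_ifs <;> simp
  rw [this]
  by_cases h : v = w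
  · subst h
    simp [lapPencil, SimpleGraph.lapMatrix, SimpleGraph.degMatrix]
  · by_cases h' : G.Adj v w <;>
      simp [lapPencil, SimpleGraph.lapMatrix, SimpleGraph.degMatrix,        h, h']

lemma lapPoly_eq_det (G : SimpleGraph V) [DecidableRel G.Adj] (υ : V → ℕ+) :
    lapPoly G υ = (lapPencil G υ).det := rfl

lemma lapPoly_comap_equiv (e : W ≃ V) (G : SimpleGraph V) [DecidableRel G.Adj]
    [DecidableRel (G.comap e).Adj] (υ : V → ℕ+) :
    lapPoly (G.comap e) (υ ∘ e) = lapPoly G υ := by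
  rw [lapPoly_eq_det, lapPoly_eq_det, ← Matrix.det_submatrix_equiv_self e]
  congr 1
  ext1 v w
  rw [Matrix.submatrix_apply, lapPencil_apply, lapPencil_apply, ← e.sum_comp]
  simp

variable (G : SimpleGraph (W ⊕ Unit)) [DecidableRel G.Adj] [DecidableRel (G.comap Sum.inl).Adj]
  (υ : W ⊕ Unit → ℕ+)

lemma lapPoly_of_isolated (h : ∀ w, ¬ G.Adj (Sum.inr ()) (Sum.inl w)) :
    lapPoly G υ = C ((υ (Sum.inr ()) : ℕ) : ℝ) * X *
      lapPoly (G.comap Sum.inl) (υ ∘ Sum.inl) := by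
  have h' w : ¬ G.Adj (Sum.inl w) (Sum.inr ()) := fun hw => h w hw.symm
  have : lapPencil G υ = Matrix.fromBlocks (lapPencil (G.comap Sum.inl) (υ ∘ Sum.inl)) 0 0
      (Matrix.diagonal fun _ => X * C ((υ (Sum.inr ()) : ℕ) : ℝ)) := by
    ext1 v w
    obtain v | ⟨⟨⟩⟩ := v <;> obtain w | ⟨⟨⟩⟩ := w <;> simp [-Finset.sum_boole, lapPencil_apply, h, h']
  rw [lapPoly_eq_det, this, Matrix.det_fromBlocks_zero₂₁, lapPoly_eq_det]
  simp only [Matrix.det_diagonal, Finset.univ_unique, Finset.prod_singleton]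
  ring

/-- Let `M` be the pencil of the graph without the leaf. The edge at `u` adds one to the degree
there, so the large block is `M` minus a unit at `(u, u)`. Contraction instead adds `c = w t` at
`(u, u)`, and `Matrix.det_fromBlocks_leaf` relates the three determinants. -/
lemma lapPoly_of_leaf {u : W} (h : ∀ w, G.Adj (Sum.inr ()) (Sum.inl w) ↔ w = u) :
    lapPoly G υ = C ((υ (Sum.inr ()) : ℕ) : ℝ) * X * lapPoly (G.comap Sum.inl) (υ ∘ Sum.inl) -
      lapPoly (G.comap Sum.inl)
        (Function.update (υ ∘ Sum.inl) u (υ (Sum.inl u) + υ (Sum.inr ()))) := by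
  have h' w : G.Adj (Sum.inl w) (Sum.inr ()) ↔ w = u := by rw [G.adj_comm, h]
  have hG : lapPencil G υ = Matrix.fromBlocks
      (lapPencil (G.comap Sum.inl) (υ ∘ Sum.inl) - Matrix.single u u 1)
      (Matrix.replicateCol Unit (Pi.single u 1)) (Matrix.replicateRow Unit (Pi.single u 1))
      (Matrix.diagonal fun _ => C ((υ (Sum.inr ()) : ℕ) : ℝ) * X - 1) := by
    ext1 v w
    obtain v | ⟨⟨⟩⟩ := v <;> obtain w | ⟨⟨⟩⟩ := w
    · by_cases hvw : v = w
      · subst hvw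
        by_cases hv : v = u
        · subst hv
          simp [-Finset.sum_boole, lapPencil_apply, h']
          ring
        · simp [-Finset.sum_boole, lapPencil_apply, h', hv, Ne.symm hv]
      · have : ¬ (u = v ∧ u = w) := fun hu => hvw (hu.1 ▸ hu.2)
        simp [-Finset.sum_boole, lapPencil_apply, hvw, this]
    · simp [-Finset.sum_boole, lapPencil_apply, h', Pi.single_apply]
    · simp [-Finset.sum_boole, lapPencil_apply, h, Pi.single_apply]
    · simp [-Finset.sum_boole, lapPencil_apply, h, mul_comm]
  have hG' : lapPencil (G.comap Sum.inl)
        (Function.update (υ ∘ Sum.inl) u (υ (Sum.inl u) + υ (Sum.inr ()))) =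
      lapPencil (G.comap Sum.inl) (υ ∘ Sum.inl) +
        (C ((υ (Sum.inr ()) : ℕ) : ℝ) * X) • Matrix.single u u 1 := by
    ext1 v w
    by_cases hvw : v = w
    · subst hvw
      by_cases hv : v = u
      · subst hv
        simp [-Finset.sum_boole, lapPencil_apply]
        ring
      · simp [-Finset.sum_boole, lapPencil_apply, hv, Ne.symm hv]
    · have : ¬ (u = v ∧ u = w) := fun hu => hvw (hu.1 ▸ hu.2)
      simp [-Finset.sum_boole, lapPencil_apply, hvw, this]
  rw [lapPoly_eq_det, hG, Matrix.det_fromBlocks_leaf, lapPoly_eq_det, lapPoly_eq_det, hG']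

end CSF

/-! ### Induction over forests. -/

/-- A finite nonempty acyclic graph has a vertex with at most one neighbour. -/
lemma SimpleGraph.IsAcyclic.exists_forall_adj_eq {V : Type*} [Fintype V] [Nonempty V]
    {G : SimpleGraph V} (hG : G.IsAcyclic) : ∃ v u : V, ∀ w, G.Adj v w → w = u := by
  let P (n : ℕ) : Prop := ∃ (u v : V) (p : G.Walk u v), p.IsPath ∧ p.length = n
  have hP : ∃ n, P n ∧ ∀ m, P m → m ≤ n := by
    have hfin : {n | P n}.Finite := (Set.finite_lt_nat (Fintype.card V)).subset
      fun n ⟨_, _, _, hp, hn⟩ => hn ▸ hp.length_lt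
    obtain ⟨v⟩ := ‹Nonempty V›
    obtain ⟨n, hn, hmax⟩ := hfin.exists_maximal ⟨0, v, v, .nil, .nil, rfl⟩
    exact ⟨n, hn, fun m hm => not_lt.mp fun h => h.not_ge (hmax hm h.le)⟩
  obtain ⟨n, ⟨u, v, p, hp, rfl⟩, hmax⟩ := hP
  -- `p` is a longest path and `v` its end. A neighbour of `v` off `p` would extend it; one on `p`
  -- must be the penultimate vertex by acyclicity.
  refine ⟨v, p.penultimate, fun w hw => hG.eq_penultimate_of_adj_end hp hw ?_⟩
  by_contra hmem
  have := hmax _ ⟨u, w, p.concat hw, hp.concat hmem hw, rfl⟩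
  rw [SimpleGraph.Walk.length_concat] at this
  lia

namespace CSF

/-- The induction hypothesis covers all weightings, since a leaf step uses the same smaller forest
with two of them. Membership in `SymAlg` follows from the same recurrence. -/
theorem lapPoly_eq_map_chromSymm {φ : SymAlg →ₐ[ℝ] ℝ[X]} (hφ : IsPhi φ) (n : ℕ)
    (V : Type*) [Fintype V] [DecidableEq V] (F : SimpleGraph V) [DecidableRel F.Adj]
    (υ : V → ℕ+) (hF : F.IsAcyclic) (hn : Fintype.card V = n) :
    ∃ hX : chromSymm F υ ∈ SymAlg, lapPoly F υ = φ ⟨chromSymm F υ, hX⟩ := by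
  classical
  induction n generalizing V with
  | zero =>
    have := Fintype.card_eq_zero_iff.mp hn
    have h1 := chromSymm_of_isEmpty F υ
    refine ⟨h1 ▸ one_mem _, ?_⟩
    have : (⟨chromSymm F υ, h1 ▸ one_mem _⟩ : SymAlg) = 1 := Subtype.ext h1
    rw [this, map_one, lapPoly, Matrix.det_isEmpty]
  | succ n ih =>
    have : Nonempty V := Fintype.card_pos_iff.mp (by lia)
    obtain ⟨v, u, hu⟩ := hF.exists_forall_adj_eq
    let e : {w // w ≠ v} ⊕ Unit ≃ V :=
      (Equiv.optionEquivSumPUnit _).symm.trans (Equiv.optionSubtypeNe v)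
    have hev : e (Sum.inr ()) = v := by simp [e]
    have hel (w : {w // w ≠ v}) : e (Sum.inl w) = w := by simp [e]
    have hcard : Fintype.card {w // w ≠ v} = n := by
      have := Fintype.card_congr e
      rw [Fintype.card_sum, hn, Fintype.card_unit] at this
      lia
    have hG : (F.comap e).IsAcyclic := hF.of_comap e.toEmbedding
    have hG' : ((F.comap e).comap Sum.inl).IsAcyclic := hG.of_comap .inl
    have hadj (w : {w // w ≠ v}) :
        (F.comap e).Adj (Sum.inr ()) (Sum.inl w) ↔ F.Adj v w := by
      rw [SimpleGraph.comap_adj, hev, hel]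
    rw [← lapPoly_comap_equiv e]
    simp only [← chromSymm_comap_equiv e F υ]
    set G := F.comap e
    set ω := υ ∘ e
    obtain ⟨hX, hX'⟩ := ih _ (G.comap Sum.inl) (ω ∘ Sum.inl) hG' hcard
    have hmul := mul_mem (powerSum_mem (ω (Sum.inr ()))) hX
    have hφmul : φ ⟨_, hmul⟩ = C ((ω (Sum.inr ()) : ℕ) : ℝ) * X *
        lapPoly (G.comap Sum.inl) (ω ∘ Sum.inl) := by
      rw [hX', ← hφ.map_powerSum, ← map_mul]
      rfl
    -- `u` is the only possible neighbour of `v`, so `v` is either a leaf at `u` or isolated.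
    by_cases hvu : F.Adj v u
    · have hleaf (w : {w // w ≠ v}) :
          G.Adj (Sum.inr ()) (Sum.inl w) ↔ w = ⟨u, hvu.ne'⟩ := by
        rw [hadj, Subtype.ext_iff]
        exact ⟨hu _, fun h => h ▸ hvu⟩
      obtain ⟨hY, hY'⟩ := ih _ (G.comap Sum.inl) (Function.update (ω ∘ Sum.inl) ⟨u, hvu.ne'⟩
        (ω (Sum.inl ⟨u, hvu.ne'⟩) + ω (Sum.inr ()))) hG' hcard
      have hsub := eq_sub_of_add_eq (chromSymm_add_of_leaf G ω hleaf).symm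
      have hsub_mem := sub_mem hmul hY
      refine ⟨hsub ▸ hsub_mem, ?_⟩
      rw [lapPoly_of_leaf G ω hleaf, hY', ← hφmul, ← map_sub]
      exact congrArg φ (Subtype.ext hsub.symm)
    · have hiso (w : {w // w ≠ v}) : ¬ G.Adj (Sum.inr ()) (Sum.inl w) := by
        rw [hadj]
        exact fun h => hvu (hu _ h ▸ h)
      have heq := chromSymm_of_isolated G ω hiso
      refine ⟨heq ▸ hmul, ?_⟩
      rw [lapPoly_of_isolated G ω hiso, ← hφmul]
      exact congrArg φ (Subtype.ext heq.symm)

end CSF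

end

theorem theorem8p3 :
    (∃! φ : CSF.SymAlg →ₐ[ℝ] ℝ[X], CSF.IsPhi φ) ∧
    ∀ φ : CSF.SymAlg →ₐ[ℝ] ℝ[X], CSF.IsPhi φ →
      ∀ (V : Type*) [Fintype V] [DecidableEq V] (F : SimpleGraph V) [DecidableRel F.Adj]
        (υ : V → ℕ+), F.IsAcyclic →
        ∃ hX : CSF.chromSymm F υ ∈ CSF.SymAlg,
          CSF.lapPoly F υ = φ ⟨CSF.chromSymm F υ, hX⟩ :=
  ⟨CSF.existsUnique_isPhi, fun _ hφ V _ _ F _ υ hF =>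
    CSF.lapPoly_eq_map_chromSymm hφ _ V F υ hF rfl⟩
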